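/- Let $n \ge 1$ be an integer and let $\epsilon < 1$ be a real number. Let $X_1, Z_1, \ldots, X_n, Z_n$ be Hermitian matrices acting on the same finite-dimensional complex Hilbert space $\mathcal{H}$, each having all its eigenvalues in $[-1, -1+\epsilon] \cup [1-\epsilon, 1]$, such that $\|\{X_j, Z_j\}\| \le \epsilon$ for all $j$, and $\|[S_i, T_j]\| \le \epsilon$ for all $i \ne j$ and all $S, T \in \{X, Z\}$. Here $[A,B] = AB - BA$, $\{A,B\} = AB + BA$, and $\|\cdot\|$ is the operator norm. Assume $\frac{\epsilon}{(1-\epsilon)^2} \le \frac{1}{64 n}$. Then there exist reflections (Hermitian matrices squaring to the identity) $X_1', Z_1', \ldots, X_n', Z_n'$ on $\mathcal{H}$ such that $\{X_j', Z_j'\} = 0$ for all $j$, $[S_i', T_j'] = 0$ for all $i \ne j$ and all $S, T \in \{X, Z\}$, and \[ \|S_j' - S_j\| \le \frac{4 n \epsilon}{(1-\epsilon)^2} + \epsilon \qquad \text{for all } j \text{ and } S \in \{X, Z\}. \] -/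

import Mathlib

open scoped Matrix.Norms.L2Operator

/-- A reflection: a Hermitian matrix that squares to the identity
(all of its eigenvalues are `1` or `-1`). -/
def IsReflectionMatrix {ι : Type*} [Fintype ι] [DecidableEq ι] (R : Matrix ι ι ℂ) : Prop :=
  R.IsHermitian ∧ R * R = 1

/-- The set `[-1, -1 + ε] ∪ [1 - ε, 1]` of real numbers in which the eigenvalues lie. -/
def nearSignSet (ε : ℝ) : Set ℝ :=
  Set.Icc (-1) (-1 + ε) ∪ Set.Icc (1 - ε) 1

/-- A Hermitian matrix all of whose (real) eigenvalues lie in `[-1, -1 + ε] ∪ [1 - ε, 1]`.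
`spectrum ℝ A` is the set of real `t` for which `t • 1 - A` is not invertible. -/
def IsNearReflectionMatrix {ι : Type*} [Fintype ι] [DecidableEq ι] (ε : ℝ)
    (A : Matrix ι ι ℂ) : Prop :=
  A.IsHermitian ∧ spectrum ℝ A ⊆ nearSignSet ε

/-- The commutator `[A, B]`. -/
def matComm {ι : Type*} [Fintype ι] (A B : Matrix ι ι ℂ) : Matrix ι ι ℂ :=
  A * B - B * A

/-- The anticommutator `{A, B}`. -/
def matAnticomm {ι : Type*} [Fintype ι] (A B : Matrix ι ι ℂ) : Matrix ι ι ℂ :=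
  A * B + B * A

/-! Write `S T = c T S` with `c = ±1`, so that commutation and anticommutation are treated alike.
Replacing each matrix by its sign gives reflections whose relations fail by at most `δ = ε / (1 - ε)
^ 2` (`norm_twistedComm_sign_le`). Then each reflection `R` of the family is used once as a pivot:
every `S` is averaged with `a R S R`, and the sign of the average is taken. All relations with `R`
become exact, exact relations of earlier pivots survive, and a defect `d` grows only to `d / (1 -
d)`, because the averaging error is a product of two defects (`norm_twistedComm_twistedPart_le`).
After `m` pivots the defect is at most `δ / (1 - m δ)`, so each of the `2n` rounds moves an element
by at most `2δ`, in total `4nδ`. -/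

section CStarReflections

variable {A : Type*} [CStarAlgebra A]

/-- A self-adjoint square root of `1` in a star ring. -/
def IsStarReflection (R : A) : Prop :=
  IsSelfAdjoint R ∧ R * R = 1

/-- The twisted commutator `S T - c T S`. -/
noncomputable def twistedComm (c : ℝ) (S T : A) : A :=
  S * T - c • (T * S)

/-- The part `(S + a R S R) / 2` of `S` that satisfies `R S = a S R`, for a reflection `R`. -/
noncomputable def twistedPart (a : ℝ) (R S : A) : A :=
  (1 / 2 : ℝ) • (S + a • (R * S * R))

theorem IsStarReflection.mem_unitary {R : A} (hR : IsStarReflection R) : R ∈ unitary A := by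
  rw [Unitary.mem_iff, hR.1.star_eq]
  exact ⟨hR.2, hR.2⟩

theorem IsStarReflection.norm_mul {R : A} (hR : IsStarReflection R) (B : A) : ‖R * B‖ = ‖B‖ :=
  CStarRing.norm_mem_unitary_mul B hR.mem_unitary

theorem IsStarReflection.mul_norm {R : A} (hR : IsStarReflection R) (B : A) : ‖B * R‖ = ‖B‖ :=
  CStarRing.norm_mul_mem_unitary B hR.mem_unitary

theorem norm_sign_smul {c : ℝ} (hc : c = 1 ∨ c = -1) (B : A) : ‖c • B‖ = ‖B‖ := by
  rcases hc with rfl | rfl <;> simp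

theorem norm_twistedComm_swap {c : ℝ} (hc : c = 1 ∨ c = -1) (S T : A) :
    ‖twistedComm c T S‖ = ‖twistedComm c S T‖ := by
  rcases hc with rfl | rfl
  · simp only [twistedComm, one_smul]
    exact norm_sub_rev _ _
  · simp only [twistedComm, neg_smul, one_smul, sub_neg_eq_add]
    rw [add_comm]

/-! ### Signs of nearly reflecting elements -/

/-- The sign of a self-adjoint element whose spectrum is close to `{1, -1}`. -/
theorem exists_reflection_near {B : A} (hB : IsSelfAdjoint B) {t : ℝ} (ht : 0 ≤ t) (ht1 : t < 1)
    (h : ∀ x ∈ spectrum ℝ B, |(|x| - 1)| ≤ t) :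
    ∃ U : A, IsStarReflection U ∧ U * B = B * U ∧ ‖U - B‖ ≤ t := by
  have hne : ∀ x ∈ spectrum ℝ B, |x| ≠ 0 := by
    intro x hx h0
    have := h x hx
    rw [h0] at this
    norm_num at this
    linarith
  have hcont : ContinuousOn (fun x : ℝ => x / |x|) (spectrum ℝ B) :=
    continuousOn_id.div continuous_abs.continuousOn hne
  refine ⟨cfc (fun x : ℝ => x / |x|) B, ⟨cfc_predicate _ B, ?_⟩, ?_, ?_⟩
  · rw [← cfc_mul _ _ B hcont hcont, ← cfc_one ℝ B]
    refine cfc_congr fun x hx => ?_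
    have := hne x hx
    simp only [Pi.one_apply]
    rw [div_mul_div_comm, abs_mul_abs_self, div_self]
    simpa using this
  · have h := (cfc_commute_cfc (fun x : ℝ => x / |x|) id B).eq
    rwa [cfc_id ℝ B] at h
  · nth_rw 2 [← cfc_id ℝ B]
    rw [← cfc_sub _ _ B hcont continuousOn_id]
    refine norm_cfc_le ht fun x hx => ?_
    have h0 := hne x hx
    have h1 := h x hx
    have : x / |x| - id x = -(x / |x|) * (|x| - 1) := by
      simp only [id]
      field_simp
      ring
    rw [this, norm_mul, norm_neg, Real.norm_eq_abs, Real.norm_eq_abs, abs_div, abs_abs,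
      div_self h0, one_mul]
    exact h1

/-- Replacing an element by its sign enlarges twisted commutators by a bounded factor. -/
theorem norm_twistedComm_sign_le {U B : A} (hU : IsStarReflection U) (hUB : U * B = B * U)
    {t : ℝ} (ht : ‖U - B‖ ≤ t) {c : ℝ} (hc : c = 1 ∨ c = -1) (T : A) :
    (1 - t) * ‖twistedComm c U T‖ ≤ ‖twistedComm c B T‖ := by
  set C := twistedComm c B T with hC
  set D := twistedComm c U T with hD
  set N := U * (U - B) with hN
  have hUU := hU.2
  have hNle : ‖N‖ ≤ t := by rwa [hN, hU.norm_mul]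
  have hE : ‖U * D‖ = ‖D‖ := hU.norm_mul D
  have hB1 : B = U - U * N := by
    rw [hN, ← mul_assoc, hUU]; noncomm_ring
  have hNU : N * U = U * N := by
    rw [hN, mul_assoc, sub_mul, ← hUB, ← mul_sub]
  -- As `U² = 1` and `c² = 1`, `U D = -c D U`; hence for `N = 0` the two terms of `U C - c C U` add
  -- up to `2 U D`. In general `B = U (1 - N)`, and the last bracket is the correction.
  have key : (2 : ℝ) • (U * D) = (U * C - c • (C * U)) + (N * (U * D) + (U * D) * N) := by
    have e1 : U * (U * N) = N := by rw [← mul_assoc, hUU, one_mul]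
    have e2 : U * N * U = N := by rw [← hNU, mul_assoc, hUU, mul_one]
    have e3 : ∀ x, U * (U * x) = x := fun x => by rw [← mul_assoc, hUU, one_mul]
    have e4 : ∀ x, U * (N * x) = N * (U * x) := fun x => by
      rw [← mul_assoc, ← hNU, mul_assoc]
    rw [hC, hD]
    unfold twistedComm
    rw [hB1]
    rcases hc with rfl | rfl
    · simp only [one_smul, two_smul, mul_sub, sub_mul, mul_assoc, e3, e4, hNU, hUU, mul_one]
      abel
    · simp only [neg_smul, one_smul, two_smul, mul_sub, sub_mul, mul_add, add_mul, mul_assoc, e3,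
        e4, hNU, hUU, mul_one, sub_neg_eq_add]
      abel
  have h1 : ‖(2 : ℝ) • (U * D)‖ = 2 * ‖D‖ := by rw [norm_smul, hE]; norm_num
  have h2 : ‖U * C - c • (C * U)‖ ≤ ‖C‖ + ‖C‖ :=
    (norm_sub_le _ _).trans (by rw [norm_sign_smul hc, hU.norm_mul, hU.mul_norm])
  have h3 : ‖N * (U * D) + (U * D) * N‖ ≤ t * ‖D‖ + ‖D‖ * t := by
    refine (norm_add_le _ _).trans (add_le_add ?_ ?_)
    · exact (norm_mul_le _ _).trans (by rw [hE]; gcongr)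
    · exact (norm_mul_le _ _).trans (by rw [hE]; gcongr)
  have h4 := norm_add_le (U * C - c • (C * U)) (N * (U * D) + (U * D) * N)
  rw [← key, h1] at h4
  linarith

/-! ### Averaging over conjugation by a reflection -/

theorem norm_reflect_sub {a : ℝ} (ha : a = 1 ∨ a = -1) {R : A} (hR : IsStarReflection R) (S : A) :
    ‖S - a • (R * S * R)‖ = ‖twistedComm a R S‖ := by
  have : S - a • (R * S * R) = -(a • (twistedComm a R S * R)) := by
    unfold twistedComm
    rcases ha with rfl | rfl
    · simp [sub_mul, mul_assoc, hR.2]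
    · simp [add_mul, mul_assoc, hR.2, add_comm]
  rw [this, norm_neg, norm_sign_smul ha, hR.mul_norm]

theorem isSelfAdjoint_twistedPart (a : ℝ) {R S : A} (hR : IsStarReflection R)
    (hS : IsSelfAdjoint S) : IsSelfAdjoint (twistedPart a R S) := by
  unfold twistedPart
  rw [IsSelfAdjoint]
  simp [hR.1.star_eq, hS.star_eq, mul_assoc]

theorem twistedComm_twistedPart_eq_zero {a : ℝ} (ha : a = 1 ∨ a = -1) {R : A}
    (hR : IsStarReflection R) (S : A) : twistedComm a R (twistedPart a R S) = 0 := by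
  have e3 : ∀ x, R * (R * x) = x := fun x => by rw [← mul_assoc, hR.2, one_mul]
  unfold twistedComm twistedPart
  rcases ha with rfl | rfl <;>
    simp only [one_smul, neg_smul, mul_smul_comm, smul_mul_assoc, mul_add, add_mul, mul_neg,
      neg_mul, mul_assoc, e3, hR.2, mul_one, smul_add, smul_neg] <;> abel

theorem norm_twistedPart_sub_le {a : ℝ} (ha : a = 1 ∨ a = -1) {R : A} (hR : IsStarReflection R)
    (S : A) : ‖twistedPart a R S - S‖ ≤ ‖twistedComm a R S‖ / 2 := by
  have : twistedPart a R S - S = -((1 / 2 : ℝ) • (S - a • (R * S * R))) := by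
    unfold twistedPart; module
  rw [this, norm_neg, norm_smul, norm_reflect_sub ha hR]
  norm_num
  linarith

/-- With `S' = a R S R`, again a square root of `1`, the parallelogram identity gives `((S + S') /
2)² + ((S - S') / 2)² = 1`. -/
theorem norm_one_sub_twistedPart_sq_le {a : ℝ} (ha : a = 1 ∨ a = -1) {R S : A}
    (hR : IsStarReflection R) (hS : IsStarReflection S) :
    ‖1 - twistedPart a R S * twistedPart a R S‖ ≤ ‖twistedComm a R S‖ ^ 2 / 4 := by
  set S' := a • (R * S * R) with hS'
  have hSsq : S' * S' = 1 := by
    have e3 : ∀ x, R * (R * x) = x := fun x => by rw [← mul_assoc, hR.2, one_mul]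
    have e4 : ∀ x, S * (S * x) = x := fun x => by rw [← mul_assoc, hS.2, one_mul]
    rcases ha with rfl | rfl <;> simp [hS', mul_assoc, e3, e4, hR.2]
  have : 1 - twistedPart a R S * twistedPart a R S = (1 / 4 : ℝ) • ((S - S') * (S - S')) := by
    unfold twistedPart
    rw [← hS']
    simp only [smul_mul_assoc, mul_smul_comm, mul_add, add_mul, mul_sub, sub_mul, hSsq, hS.2]
    module
  rw [this, norm_smul]
  have h := norm_mul_le (S - S') (S - S')
  rw [hS', norm_reflect_sub ha hR, ← hS'] at h
  norm_num
  nlinarith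

/-- The mixed terms of the twisted commutator of `S` and `T` drop out of that of their parts, so
the error is quadratic. -/
theorem norm_twistedComm_twistedPart_le {a b c : ℝ} (ha : a = 1 ∨ a = -1) (hb : b = 1 ∨ b = -1)
    (hc : c = 1 ∨ c = -1) {R : A} (hR : IsStarReflection R) (S T : A) :
    ‖twistedComm c (twistedPart a R S) (twistedPart b R T)‖ ≤
      ‖twistedComm c S T‖ + ‖twistedComm a R S‖ * ‖twistedComm b R T‖ / 2 := by
  set S' := a • (R * S * R) with hS'
  set T' := b • (R * T * R) with hT'
  have hX : twistedComm c S' T' = (a * b) • (R * twistedComm c S T * R) := by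
    have e3 : ∀ x, R * (R * x) = x := fun x => by rw [← mul_assoc, hR.2, one_mul]
    simp only [hS', hT', twistedComm, smul_mul_assoc, mul_smul_comm, mul_sub, sub_mul, mul_assoc,
      e3]
    module
  have hX' : ‖twistedComm c S' T'‖ = ‖twistedComm c S T‖ := by
    rw [hX, mul_smul, norm_sign_smul ha, norm_sign_smul hb, hR.mul_norm, hR.norm_mul]
  -- Polarization: a product of averages is the average of the products minus a quarter of the
  -- product of the differences.
  have hD : twistedComm c (twistedPart a R S) (twistedPart b R T) =
      (1 / 2 : ℝ) • (twistedComm c S T + twistedComm c S' T') -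
        (1 / 4 : ℝ) • ((S - S') * (T - T') - c • ((T - T') * (S - S'))) := by
    unfold twistedPart
    rw [← hS', ← hT']
    simp only [twistedComm, smul_mul_assoc, mul_smul_comm, mul_add, add_mul, mul_sub, sub_mul]
    module
  have h1 : ‖S - S'‖ = ‖twistedComm a R S‖ := norm_reflect_sub ha hR S
  have h2 : ‖T - T'‖ = ‖twistedComm b R T‖ := norm_reflect_sub hb hR T
  have h3 := norm_mul_le (S - S') (T - T')
  have h4 := norm_mul_le (T - T') (S - S')
  have h5 := norm_sub_le ((S - S') * (T - T')) (c • ((T - T') * (S - S')))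
  rw [norm_sign_smul hc] at h5
  have h6 := norm_add_le (twistedComm c S T) (twistedComm c S' T')
  rw [hD]
  refine (norm_sub_le _ _).trans ?_
  rw [norm_smul, norm_smul]
  rw [h1, h2] at h3 h4
  norm_num
  nlinarith

/-- A reflection that satisfies `R U = a U R` exactly, close to a reflection that satisfies it
approximately. -/
theorem exists_reflection_near_twistedPart {a : ℝ} (ha : a = 1 ∨ a = -1) {R S : A}
    (hR : IsStarReflection R) (hS : IsStarReflection S) (h : ‖twistedComm a R S‖ ≤ 1) :
    ∃ U : A, IsStarReflection U ∧ U * twistedPart a R S = twistedPart a R S * U ∧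
      ‖U - twistedPart a R S‖ ≤ ‖twistedComm a R S‖ ^ 2 / 4 := by
  have h0 := norm_nonneg (twistedComm a R S)
  have hsa := isSelfAdjoint_twistedPart a hR hS.1
  refine exists_reflection_near hsa (by positivity) (by nlinarith) fun x hx => ?_
  have h1 : ‖1 - x * x‖ ≤ ‖1 - twistedPart a R S * twistedPart a R S‖ := by
    have e : cfc (fun y : ℝ => 1 - y * y) (twistedPart a R S) =
        1 - twistedPart a R S * twistedPart a R S := by
      rw [cfc_sub _ _ _, cfc_mul _ _ _, cfc_id' ℝ (twistedPart a R S), cfc_const_one ℝ _]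
    rw [← e]
    exact norm_apply_le_norm_cfc (fun y : ℝ => 1 - y * y) _ hx
  have h2 := h1.trans (norm_one_sub_twistedPart_sq_le ha hR hS)
  refine le_trans ?_ h2
  have h3 : 1 - x * x = -((|x| - 1) * (|x| + 1)) := by
    rw [← abs_mul_abs_self x]; ring
  rw [h3, norm_neg, norm_mul, Real.norm_eq_abs, Real.norm_eq_abs]
  have h4 : 1 ≤ |(|x| + 1)| := by
    rw [abs_of_nonneg (by positivity)]; linarith [abs_nonneg x]
  exact le_mul_of_one_le_right (abs_nonneg _) h4


/-! ### Pivoting on one reflection at a time -/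

/-- Making all members of a finite family of reflections satisfy their relation with one fixed
member exactly. -/
theorem exists_exact_relations_with_one {I : Type*} {c : I → I → ℝ}
    (hc : ∀ i j, c i j = 1 ∨ c i j = -1) (hsymm : ∀ i j, c i j = c j i) (hdiag : ∀ i, c i i = 1)
    {R : I → A} (hR : ∀ i, IsStarReflection (R i)) {s : Set I}
    (hs : ∀ i ∈ s, ∀ j, twistedComm (c i j) (R i) (R j) = 0)
    {d : ℝ} (hd : ∀ i j, ‖twistedComm (c i j) (R i) (R j)‖ ≤ d) (hd1 : d ≤ 1 / 2) (k : I) :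
    ∃ U : I → A, (∀ i, IsStarReflection (U i)) ∧
      (∀ i ∈ insert k s, ∀ j, twistedComm (c i j) (U i) (U j) = 0) ∧
      (∀ i j, ‖twistedComm (c i j) (U i) (U j)‖ ≤ d / (1 - d)) ∧
      ∀ i, ‖U i - R i‖ ≤ d / 2 + d ^ 2 / 4 := by
  have hd0 : 0 ≤ d := (norm_nonneg _).trans (hd k k)
  choose U hU hUcomm hUnear using fun i =>
    exists_reflection_near_twistedPart (hc k i) (hR k) (hR i) ((hd k i).trans (by linarith))
  have hkk : ‖twistedComm (c k k) (R k) (R k)‖ = 0 := by simp [twistedComm, hdiag]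
  -- The pivot commutes with itself, so the averaging leaves it fixed.
  have hUk : U k = R k := by
    have h1 := hUnear k
    have h2 := norm_twistedPart_sub_le (hc k k) (hR k) (R k)
    rw [hkk] at h1 h2
    have h3 : U k - twistedPart (c k k) (R k) (R k) = 0 := norm_le_zero_iff.1 (by simpa using h1)
    have h4 : twistedPart (c k k) (R k) (R k) - R k = 0 := norm_le_zero_iff.1 (by simpa using h2)
    rw [sub_eq_zero.1 h3, sub_eq_zero.1 h4]
  have hsq : ∀ i, ‖twistedComm (c k i) (R k) (R i)‖ ^ 2 / 4 ≤ d ^ 2 / 4 := fun i => by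
    have := hd k i
    gcongr
  have hpos : 0 < 1 - d ^ 2 / 4 := by nlinarith
  have hpair : ∀ i j, (1 - d ^ 2 / 4) ^ 2 * ‖twistedComm (c i j) (U i) (U j)‖ ≤
      ‖twistedComm (c i j) (R i) (R j)‖ +
        ‖twistedComm (c k i) (R k) (R i)‖ * ‖twistedComm (c k j) (R k) (R j)‖ / 2 := by
    intro i j
    have h1 := norm_twistedComm_sign_le (hU i) (hUcomm i) ((hUnear i).trans (hsq i)) (hc i j) (U j)
    have h2 := norm_twistedComm_sign_le (hU j) (hUcomm j) ((hUnear j).trans (hsq j)) (hc i j)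
      (twistedPart (c k i) (R k) (R i))
    rw [norm_twistedComm_swap (hc i j) _ (U j),
      norm_twistedComm_swap (hc i j) _ (twistedPart (c k j) (R k) (R j))] at h2
    have h3 := norm_twistedComm_twistedPart_le (hc k i) (hc k j) (hc i j) (hR k) (R i) (R j)
    calc _ = (1 - d ^ 2 / 4) * ((1 - d ^ 2 / 4) * ‖twistedComm (c i j) (U i) (U j)‖) := by ring
      _ ≤ (1 - d ^ 2 / 4) * _ := mul_le_mul_of_nonneg_left h1 hpos.le
      _ ≤ _ := h2
      _ ≤ _ := h3
  refine ⟨U, hU, ?_, ?_, ?_⟩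
  · rintro i (rfl | hi) j
    · have h := norm_twistedComm_sign_le (hU j) (hUcomm j) (le_refl _) (hc i j) (R i)
      rw [norm_twistedComm_swap (hc i j) _ (U j),
        norm_twistedComm_swap (hc i j) _ (twistedPart (c i j) (R i) (R j)),
        twistedComm_twistedPart_eq_zero (hc i j) (hR i), norm_zero] at h
      have h1 := (hUnear j).trans (hsq j)
      rw [hUk]
      have h2 := norm_nonneg (twistedComm (c i j) (R i) (U j))
      exact norm_eq_zero.1 (by nlinarith)
    -- An earlier pivot `i` is exact with both `j` and `k`, so both terms on the right of `hpair`
    -- vanish.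
    · have h := hpair i j
      have hk : twistedComm (c k i) (R k) (R i) = 0 := by
        have := norm_twistedComm_swap (hc i k) (R i) (R k)
        rw [hs i hi k, norm_zero, norm_eq_zero, hsymm] at this
        exact this
      rw [hs i hi j, hk] at h
      simp only [norm_zero, zero_mul, zero_div, add_zero] at h
      have h2 := norm_nonneg (twistedComm (c i j) (U i) (U j))
      have h3 : 0 < (1 - d ^ 2 / 4) ^ 2 := by positivity
      exact norm_eq_zero.1 (by nlinarith)
  · intro i j
    have h := hpair i j
    have h1 : ‖twistedComm (c k i) (R k) (R i)‖ * ‖twistedComm (c k j) (R k) (R j)‖ ≤ d * d :=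
      mul_le_mul (hd k i) (hd k j) (norm_nonneg _) hd0
    have h2 := hd i j
    set x := ‖twistedComm (c i j) (U i) (U j)‖
    have hx : 0 ≤ x := norm_nonneg _
    have h3 : (1 - d ^ 2 / 4) ^ 2 * x ≤ d * (1 + d / 2) := by linarith
    -- This weakens the bound to `d / (1 - d)`, whose iterates have a closed form.
    have h4 : (1 - d) * (1 + d / 2) ≤ (1 - d ^ 2 / 4) ^ 2 := by
      nlinarith [pow_nonneg hd0 4, pow_nonneg hd0 3]
    have h5 : ((1 - d) * x) * (1 + d / 2) ≤ d * (1 + d / 2) := by nlinarith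
    rw [le_div_iff₀ (by linarith), mul_comm]
    exact le_of_mul_le_mul_right h5 (by linarith)
  · intro i
    have h1 := norm_twistedPart_sub_le (hc k i) (hR k) (R i)
    have h2 := (hUnear i).trans (hsq i)
    have h3 := hd k i
    calc ‖U i - R i‖ ≤ ‖U i - twistedPart (c k i) (R k) (R i)‖ +
          ‖twistedPart (c k i) (R k) (R i) - R i‖ := norm_sub_le_norm_sub_add_norm_sub _ _ _
      _ ≤ _ := by linarith

/-- Stability of sign relations: a finite family of reflections that pairwise commute or
anticommute up to `δ` is close to one whose relations hold exactly. -/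
theorem exists_exact_relations {I : Type*} [Fintype I] [DecidableEq I] {c : I → I → ℝ}
    (hc : ∀ i j, c i j = 1 ∨ c i j = -1) (hsymm : ∀ i j, c i j = c j i) (hdiag : ∀ i, c i i = 1)
    {R : I → A} (hR : ∀ i, IsStarReflection (R i)) {δ : ℝ} (hδ0 : 0 ≤ δ)
    (hδ : ∀ i j, ‖twistedComm (c i j) (R i) (R j)‖ ≤ δ) (hδI : Fintype.card I * δ ≤ 1 / 2)
    (s : Finset I) :
    ∃ U : I → A, (∀ i, IsStarReflection (U i)) ∧
      (∀ i ∈ s, ∀ j, twistedComm (c i j) (U i) (U j) = 0) ∧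
      (∀ i j, ‖twistedComm (c i j) (U i) (U j)‖ ≤ δ / (1 - s.card * δ)) ∧
      ∀ i, ‖U i - R i‖ ≤ s.card * (2 * δ) := by
  induction s using Finset.induction_on with
  | empty => exact ⟨R, hR, by simp, by simpa using hδ, by simp⟩
  | insert k s hk ih =>
    obtain ⟨V, hV, hVs, hVd, hVn⟩ := ih
    have hcard : (s.card : ℝ) + 1 ≤ Fintype.card I := by
      have := Finset.card_le_univ (insert k s)
      rw [Finset.card_insert_of_notMem hk] at this
      exact_mod_cast this
    have hb : (s.card : ℝ) * δ + δ ≤ 1 / 2 := by nlinarith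
    have hpos : 0 < 1 - (s.card : ℝ) * δ := by linarith
    have hd1 : δ / (1 - s.card * δ) ≤ 1 / 2 := by
      rw [div_le_iff₀ hpos]; nlinarith [mul_nonneg (Nat.cast_nonneg (α := ℝ) s.card) hδ0]
    have hd2 : δ / (1 - s.card * δ) ≤ 2 * δ := by
      rw [div_le_iff₀ hpos]; nlinarith [mul_nonneg (Nat.cast_nonneg (α := ℝ) s.card) hδ0]
    have hd0 : 0 ≤ δ / (1 - s.card * δ) := by positivity
    obtain ⟨U, hU, hUs, hUd, hUn⟩ := exists_exact_relations_with_one hc hsymm hdiag hV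
      (s := (s : Set I)) hVs hVd hd1 k
    refine ⟨U, hU, fun i hi => hUs i (by simpa using hi), fun i j => (hUd i j).trans_eq ?_,
      fun i => ?_⟩
    · rw [Finset.card_insert_of_notMem hk]
      push_cast
      have h1 : 1 - ((s.card : ℝ) + 1) * δ ≠ 0 := by nlinarith
      have h2 : 1 - δ / (1 - s.card * δ) = (1 - (s.card + 1) * δ) / (1 - s.card * δ) := by
        rw [eq_div_iff hpos.ne', sub_mul, div_mul_cancel₀ _ hpos.ne']; ring
      rw [h2, div_div_div_cancel_right₀ hpos.ne']
    · rw [Finset.card_insert_of_notMem hk]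
      push_cast
      have h1 := norm_sub_le_norm_sub_add_norm_sub (U i) (V i) (R i)
      have h2 := hUn i
      have h3 := hVn i
      nlinarith

end CStarReflections

/-! ### Application to matrices -/

theorem isReflectionMatrix_of_isStarReflection {ι : Type*} [Fintype ι] [DecidableEq ι]
    {R : Matrix ι ι ℂ} (hR : IsStarReflection R) : IsReflectionMatrix R :=
  ⟨hR.1, hR.2⟩

theorem IsNearReflectionMatrix.exists_reflection_near {ι : Type*} [Fintype ι] [DecidableEq ι]
    {ε : ℝ} (hε : 0 ≤ ε) (hε1 : ε < 1) {B : Matrix ι ι ℂ} (hB : IsNearReflectionMatrix ε B) :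
    ∃ U : Matrix ι ι ℂ, IsStarReflection U ∧ U * B = B * U ∧ ‖U - B‖ ≤ ε := by
  refine _root_.exists_reflection_near (A := Matrix ι ι ℂ) hB.1 hε hε1 fun x hx => ?_
  rcases hB.2 hx with ⟨h1, h2⟩ | ⟨h1, h2⟩
  · rw [abs_of_neg (by linarith : x < 0), abs_le]; constructor <;> linarith
  · rw [abs_of_pos (by linarith : 0 < x), abs_le]; constructor <;> linarith

/-- The signs are taken one factor at a time, each costing `1 - ε`. -/
theorem norm_twistedComm_sign_sign_le {A : Type*} [CStarAlgebra A] {U V B C : A}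
    (hU : IsStarReflection U) (hUB : U * B = B * U) (hV : IsStarReflection V)
    (hVC : V * C = C * V) {ε : ℝ} (hε1 : ε < 1) (hUn : ‖U - B‖ ≤ ε) (hVn : ‖V - C‖ ≤ ε)
    {c : ℝ} (hc : c = 1 ∨ c = -1) :
    ‖twistedComm c U V‖ ≤ ‖twistedComm c B C‖ / (1 - ε) ^ 2 := by
  have h1 := norm_twistedComm_sign_le hU hUB hUn hc V
  have h2 := norm_twistedComm_sign_le hV hVC hVn hc B
  rw [norm_twistedComm_swap hc _ V, norm_twistedComm_swap hc _ C] at h2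
  have h3 : 0 < 1 - ε := by linarith
  rw [le_div_iff₀ (by positivity)]
  nlinarith

/-- The sign pattern of the relations between the `X` and `Z` operators of `n` qubits, the label
`true` standing for `X` and `false` for `Z`. -/
def pauliSign {n : ℕ} (p q : Fin n × Bool) : ℝ :=
  if p.1 = q.1 ∧ p.2 ≠ q.2 then -1 else 1

/-- Norms of matrices are operator norms with respect to the Euclidean norm. -/
theorem theoremt {ι : Type*} [Fintype ι] [DecidableEq ι] (n : ℕ) (ε : ℝ)
    (X Z : Fin n → Matrix ι ι ℂ)
    (hX : ∀ j, IsNearReflectionMatrix ε (X j))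
    (hZ : ∀ j, IsNearReflectionMatrix ε (Z j))
    (hXZ : ∀ j, ‖matAnticomm (X j) (Z j)‖ ≤ ε)
    (hST : ∀ S ∈ ({X, Z} : Set (Fin n → Matrix ι ι ℂ)),
      ∀ T ∈ ({X, Z} : Set (Fin n → Matrix ι ι ℂ)),
        ∀ i j, i ≠ j → ‖matComm (S i) (T j)‖ ≤ ε)
    (hε_one : ε < 1)
    (hε : ε / (1 - ε) ^ 2 ≤ 1 / (64 * (n : ℝ))) :
    ∃ X' Z' : Fin n → Matrix ι ι ℂ,
      (∀ j, IsReflectionMatrix (X' j)) ∧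
      (∀ j, IsReflectionMatrix (Z' j)) ∧
      (∀ j, matAnticomm (X' j) (Z' j) = 0) ∧
      (∀ S ∈ ({X', Z'} : Set (Fin n → Matrix ι ι ℂ)),
        ∀ T ∈ ({X', Z'} : Set (Fin n → Matrix ι ι ℂ)),
          ∀ i j, i ≠ j → matComm (S i) (T j) = 0) ∧
      (∀ j, ‖X' j - X j‖ ≤ 4 * n * ε / (1 - ε) ^ 2 + ε) ∧
      (∀ j, ‖Z' j - Z j‖ ≤ 4 * n * ε / (1 - ε) ^ 2 + ε) := by
  -- For `n = 0` there is no anticommutator to force `0 ≤ ε`, but the families are empty.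
  rcases Nat.eq_zero_or_pos n with rfl | hn
  · exact ⟨X, Z, fun j => j.elim0, fun j => j.elim0, fun j => j.elim0,
      fun _ _ _ _ j => j.elim0, fun j => j.elim0, fun j => j.elim0⟩
  have hε0 : 0 ≤ ε := (norm_nonneg _).trans (hXZ ⟨0, hn⟩)
  let W : Fin n × Bool → Matrix ι ι ℂ := fun p => bif p.2 then X p.1 else Z p.1
  have hW : ∀ p, IsNearReflectionMatrix ε (W p) := by
    rintro ⟨j, _ | _⟩
    · exact hZ j
    · exact hX j
  choose R hR hRW hRn using fun p => (hW p).exists_reflection_near hε0 hε_one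
  have hsign : ∀ p q : Fin n × Bool, pauliSign p q = 1 ∨ pauliSign p q = -1 := by
    intro p q
    unfold pauliSign
    split_ifs
    exacts [Or.inr rfl, Or.inl rfl]
  have hsymm : ∀ p q : Fin n × Bool, pauliSign p q = pauliSign q p := by
    intro p q
    simp only [pauliSign, eq_comm (a := p.1), ne_comm (a := p.2)]
  have hdiag : ∀ p : Fin n × Bool, pauliSign p p = 1 := by simp [pauliSign]
  have hWrel : ∀ p q, ‖twistedComm (pauliSign p q) (W p) (W q)‖ ≤ ε := by
    have hcomm : ∀ i j a b, i ≠ j → ‖twistedComm 1 (W (i, a)) (W (j, b))‖ ≤ ε := by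
      intro i j a b hij
      have := hST (fun i => W (i, a)) (by cases a <;> simp [W]) (fun i => W (i, b))
        (by cases b <;> simp [W]) i j hij
      simpa [twistedComm, matComm] using this
    rintro ⟨i, a⟩ ⟨j, b⟩
    by_cases hij : i = j
    · subst hij
      have h := hXZ i
      cases a <;> cases b <;> simp [pauliSign, twistedComm, W, hε0] <;>
        simpa [matAnticomm, add_comm] using h
    · simpa [pauliSign, hij] using hcomm i j a b hij
  set δ := ε / (1 - ε) ^ 2 with hδ
  have hδ0 : 0 ≤ δ := by positivity
  have hRrel : ∀ p q, ‖twistedComm (pauliSign p q) (R p) (R q)‖ ≤ δ := fun p q =>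
    (norm_twistedComm_sign_sign_le (hR p) (hRW p) (hR q) (hRW q) hε_one (hRn p) (hRn q)
      (hsign p q)).trans (by have := hWrel p q; rw [hδ]; gcongr)
  have hcard : (Fintype.card (Fin n × Bool) : ℝ) = 2 * n := by
    simp [mul_comm]
  have hn' : (0 : ℝ) < n := by exact_mod_cast hn
  have hsmall : (Fintype.card (Fin n × Bool) : ℝ) * δ ≤ 1 / 2 := by
    rw [le_div_iff₀ (by positivity)] at hε
    rw [hcard]
    nlinarith
  obtain ⟨U, hU, hUrel, -, hUn⟩ :=
    exists_exact_relations hsign hsymm hdiag hR hδ0 hRrel hsmall Finset.univ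
  have hclose : ∀ p, ‖U p - W p‖ ≤ 4 * n * ε / (1 - ε) ^ 2 + ε := by
    intro p
    have h1 := norm_sub_le_norm_sub_add_norm_sub (U p) (R p) (W p)
    have h2 := hUn p
    have h3 := hRn p
    rw [Finset.card_univ, hcard] at h2
    rw [mul_div_assoc, ← hδ]
    linarith
  refine ⟨fun j => U (j, true), fun j => U (j, false),
    fun j => isReflectionMatrix_of_isStarReflection (hU _),
    fun j => isReflectionMatrix_of_isStarReflection (hU _), fun j => ?_, ?_,
    fun j => hclose (j, true), fun j => hclose (j, false)⟩
  · simpa [twistedComm, pauliSign, matAnticomm] using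
      hUrel (j, true) (Finset.mem_univ _) (j, false)
  · have hcomm : ∀ i j a b, i ≠ j → matComm (U (i, a)) (U (j, b)) = 0 := by
      intro i j a b hij
      simpa [twistedComm, pauliSign, matComm, hij] using
        hUrel (i, a) (Finset.mem_univ _) (j, b)
    rintro S (rfl | rfl) T (rfl | rfl) i j hij <;> exact hcomm i j _ _ hij
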